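/- Let $w$ be a finite word over the alphabet $\{a,b\}$, let $|w|$ denote its length, and let $s(w)$ denote the number of distinct nonempty squares in $w$, that is, the number of distinct words of the form $uu$ with $u$ a nonempty word that occur in $w$ as a block of consecutive letters. Let $k$ be the smaller of the number of $a$'s and the number of $b$'s in $w$. If $k \ge 2$, then $$s(w) \le \frac{2k-1}{2k+2}\,|w|.$$ -/

import Mathlib

/-- The two-letter alphabet `{a, b}`. -/
inductive Letter where
  | a : Letter
  | b : Letter
  deriving DecidableEq

/-- The set of nonempty squares occurring in the word `w`: the words `u u` with `u` nonempty that are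
factors (blocks of consecutive letters) of `w`. -/
def squares {α : Type*} (w : List α) : Set (List α) :=
  {v | (∃ u : List α, u ≠ [] ∧ v = u ++ u) ∧ v <:+: w}

/-- A word has only finitely many squares, so that counting them by `Set.ncard` is meaningful. -/
theorem squares_finite {α : Type*} (w : List α) : (squares w).Finite :=
  (List.finite_toSet w.sublists).subset fun _ hv => List.mem_sublists.2 hv.2.sublist

/-- `s(w)`: the number of distinct (nonempty) squares in `w`. -/
noncomputable def numSquares {α : Type*} (w : List α) : ℕ :=
  (squares w).ncard

/-! Let `w` have length `n`. The Rauzy graph of order `l` has the factors of length `l` as vertices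
and those of length `l + 1` as edges. The first edges of all its circuits of length `q ≤ l` (powers
of Lyndon words) can be deleted together without disconnecting it, so there are at most |E| - |V| +
1 such circuits. Summing over `l` telescopes to `n` minus the number of letters
(`card_biUnion_circuitEdges_add_le`). The squares inject into the circuits with `l / q` odd
(`numSquares_le_card_oddEdges`).

The improvement counts what this wastes. With b the rarer letter, `w` followed by b is a product of
`k + 1` blocks a^r b; let `A ≥ B` be the two largest exponents. For `l ≤ B` the edge a^l b can be
deleted too, because a^l recurs: gain `B`. The loops at a of even order below `A` carry no square:
gain `(A - 1) / 2`. A cube of a conjugate of a^A b gives one more circuit with `l / q = 2`.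
`numSquares_add_le` collects these gains, and n ≤ A + kB + k turns them into the bound. If `A = B`
and no such cube is available, either `k = 2` or shorter runs are frequent enough
(`List.length_add_three_mul_sum_le`). -/

/-- The block of length `m` at position `i` of an infinite word. -/
def fac {α : Type*} (x : ℕ → α) (i m : ℕ) : List α := (List.range m).map fun t => x (i + t)

@[simp] theorem length_fac {α : Type*} (x : ℕ → α) (i m : ℕ) : (fac x i m).length = m := by
  simp [fac]

theorem fac_eq_iff {α : Type*} {x y : ℕ → α} {i j m : ℕ} :
    fac x i m = fac y j m ↔ ∀ t < m, x (i + t) = y (j + t) := by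
  simp [fac]

theorem fac_append {α : Type*} (x : ℕ → α) (i m m' : ℕ) :
    fac x i (m + m') = fac x i m ++ fac x (i + m) m' := by
  simp [fac, List.range_add, Function.comp_def, add_assoc]

theorem fac_eq_replicate {α : Type*} {x : ℕ → α} {i m : ℕ} {c : α} :
    fac x i m = List.replicate m c ↔ ∀ t < m, x (i + t) = c := by
  simp [fac, List.eq_replicate_iff]

theorem fac_add_period {α : Type*} {x : ℕ → α} {q : ℕ} (h : Function.Periodic x q) (i m : ℕ) :
    fac x (i + q) m = fac x i m := by
  rw [fac_eq_iff]
  intro t _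
  rw [add_right_comm, h]

theorem fac_mod_period {α : Type*} {x : ℕ → α} {q : ℕ} (h : Function.Periodic x q) (i m : ℕ) :
    fac x (i % q) m = fac x i m := by
  rw [fac_eq_iff]
  intro t _
  rw [← h.map_mod_nat, ← h.map_mod_nat (i + t), Nat.mod_add_mod]

/-- The set of blocks of length `m` in the prefix of length `n` of an infinite word. -/
def factors {α : Type*} [DecidableEq α] (y : ℕ → α) (n m : ℕ) : Finset (List α) :=
  (Finset.range (n + 1 - m)).image fun i => fac y i m

theorem mem_factors {α : Type*} [DecidableEq α] {y : ℕ → α} {n m : ℕ} {v : List α} :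
    v ∈ factors y n m ↔ ∃ i, i + m ≤ n ∧ fac y i m = v := by
  simp only [factors, Finset.mem_image, Finset.mem_range]
  constructor <;> rintro ⟨i, h, h'⟩ <;> exact ⟨i, by omega, h'⟩

theorem fac_mem_factors_of_le {α : Type*} [DecidableEq α] {x y : ℕ → α} {n i m j m' : ℕ}
    (h : fac x i m ∈ factors y n m) (hij : i ≤ j) (hm : j + m' ≤ i + m) :
    fac x j m' ∈ factors y n m' := by
  obtain ⟨z, hz, hzz⟩ := mem_factors.1 h
  rw [fac_eq_iff] at hzz
  refine mem_factors.2 ⟨z + (j - i), by omega, fac_eq_iff.2 fun t ht => ?_⟩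
  have := hzz (j - i + t) (by omega)
  rw [← add_assoc, ← add_assoc, Nat.add_sub_cancel' hij] at this
  exact this

theorem Function.Periodic.mod_nat {α : Type*} {x : ℕ → α} {q N : ℕ} (hq : Function.Periodic x q)
    (hN : Function.Periodic x N) : Function.Periodic x (N % q) := by
  intro i
  rw [← hq.map_mod_nat, Nat.add_mod_mod, hq.map_mod_nat, hN]

theorem Pi.toLex_shift_le {α : Type*} [LinearOrder α] {x y : ℕ → α} {m : ℕ}
    (h : toLex x ≤ toLex y) (hm : ∀ t < m, x t = y t) :
    toLex (fun t => x (t + m)) ≤ toLex (fun t => y (t + m)) := by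
  rcases h.eq_or_lt with h | h
  · have : x = y := toLex.injective h
    rw [this]
  · obtain ⟨j, hj, hlt⟩ := h
    have hmj : m ≤ j := by
      by_contra hc
      exact hlt.ne (hm j (by omega))
    refine le_of_lt ⟨j - m, fun t ht => hj (t + m) (by omega), ?_⟩
    change x (j - m + m) < y (j - m + m)
    rw [Nat.sub_add_cancel hmj]
    exact hlt

/-! ### Lyndon powers -/

/-- `x` is the infinite power of a Lyndon word of length `q`: it is periodic, the prefix of length `q`
is unbordered, and `x` is lexicographically least among its shifts. -/
structure IsLyndonPower {α : Type*} [LinearOrder α] (x : ℕ → α) (q : ℕ) : Prop where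
  pos : 0 < q
  periodic : Function.Periodic x q
  unbordered : ∀ d, 0 < d → d < q → ∃ i, i + d < q ∧ x (i + d) ≠ x i
  least : ∀ i, toLex x ≤ toLex fun t => x (t + i)

/-- Take the least period and the lexicographically least shift. -/
theorem exists_isLyndonPower {α : Type*} [LinearOrder α] {x : ℕ → α} {N : ℕ} (hN : 0 < N)
    (hx : Function.Periodic x N) :
    ∃ z q i, IsLyndonPower z q ∧ q ∣ N ∧ i < q ∧ ∀ t, x t = z (t + i) := by
  classical
  have hex : ∃ q, 0 < q ∧ Function.Periodic x q := ⟨N, hN, hx⟩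
  obtain ⟨hq, hper⟩ := Nat.find_spec hex
  have hmin : ∀ d, 0 < d → d < Nat.find hex → ¬ Function.Periodic x d :=
    fun d hd hlt h => Nat.find_min hex hlt ⟨hd, h⟩
  generalize Nat.find hex = q at hq hper hmin
  obtain ⟨i₀, hi₀, hleast⟩ := Finset.exists_min_image (Finset.range q)
    (fun i => toLex fun t => x (t + i)) ⟨0, by simpa using hq⟩
  rw [Finset.mem_range] at hi₀
  have hzper : Function.Periodic (fun t => x (t + i₀)) q := fun t => by
    change x (t + q + i₀) = x (t + i₀)
    rw [add_right_comm, hper]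
  have hle : ∀ i, toLex (fun t => x (t + i₀)) ≤ toLex fun t => x (t + i + i₀) := by
    intro i
    refine (hleast ((i + i₀) % q) (by simpa using Nat.mod_lt _ hq)).trans_eq ?_
    congr 1
    funext t
    rw [← hper.map_mod_nat, Nat.add_mod_mod, hper.map_mod_nat, add_assoc]
  have hback : ∀ t, x t = x (t + (q - i₀) % q + i₀) := by
    intro t
    rw [← hper.map_mod_nat (t + (q - i₀) % q + i₀), add_right_comm, Nat.add_mod_mod,
      hper.map_mod_nat, add_assoc, Nat.add_sub_cancel' hi₀.le, hper]
  refine ⟨fun t => x (t + i₀), q, (q - i₀) % q, ⟨hq, hzper, ?_, hle⟩, ?_, Nat.mod_lt _ hq, hback⟩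
  · intro d hd hdq
    by_contra! hcon
    -- Cancelling the border of length `q - d` shows that the shift by `q - d` is at most the word
    -- itself; by minimality they agree, so `q - d` is a period.
    have h1 := Pi.toLex_shift_le (m := q - d) (hle d) fun t ht => (hcon t (by omega)).symm
    have h2 : (fun t => x (t + (q - d) + d + i₀)) = fun t => x (t + i₀) := by
      funext t
      rw [add_assoc t, Nat.sub_add_cancel hdq.le]
      exact hzper t
    rw [h2] at h1
    have h3 := toLex.injective (le_antisymm h1 (hle _))
    refine hmin (q - d) (by omega) (by omega) fun t => ?_
    rw [hback (t + (q - d)), hback t]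
    have := congrFun h3 (t + (q - i₀) % q)
    rw [← this]
    congr 1
    omega
  · rw [Nat.dvd_iff_mod_eq_zero]
    by_contra hne
    exact hmin _ (Nat.pos_of_ne_zero hne) (Nat.mod_lt _ hq) (hper.mod_nat hx)

/-- A Lyndon power is determined by any prefix longer than its period. -/
theorem IsLyndonPower.le_of_periodic_prefix {α : Type*} [LinearOrder α] {x z : ℕ → α} {q p i l : ℕ}
    (hx : IsLyndonPower x q) (hql : q ≤ l) (hp : 0 < p) (hz : Function.Periodic z p)
    (h : fac x 0 l = fac z i l) : q ≤ p := by
  by_contra! hlt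
  obtain ⟨j, hj, hne⟩ := hx.unbordered p hp hlt
  rw [fac_eq_iff] at h
  have h1 := h (j + p) (by omega)
  have h2 := h j (by omega)
  rw [← add_assoc i, hz] at h1
  rw [zero_add] at h1 h2
  exact hne (h1.trans h2.symm)

theorem Function.Periodic.eq_of_fac_eq {α : Type*} {x z : ℕ → α} {q i l : ℕ} (hq : 0 < q)
    (hx : Function.Periodic x q) (hz : Function.Periodic z q) (hql : q ≤ l)
    (h : fac x 0 l = fac z i l) : x = fun t => z (t + i) := by
  funext t
  rw [fac_eq_iff] at h
  have := h (t % q) ((Nat.mod_lt _ hq).trans_le hql)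
  rw [zero_add, hx.map_mod_nat] at this
  rw [this, ← hz.map_mod_nat, Nat.add_mod_mod, hz.map_mod_nat, add_comm]

theorem IsLyndonPower.eq_of_prefix_eq {α : Type*} [LinearOrder α] {x z : ℕ → α} {q p l : ℕ}
    (hx : IsLyndonPower x q) (hz : IsLyndonPower z p) (hql : q ≤ l) (hpl : p ≤ l)
    (h : fac x 0 l = fac z 0 l) : x = z ∧ q = p := by
  have hqp : q = p := le_antisymm (hx.le_of_periodic_prefix hql hz.pos hz.periodic h)
    (hz.le_of_periodic_prefix hpl hx.pos hx.periodic h.symm)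
  subst hqp
  exact ⟨hx.periodic.eq_of_fac_eq hx.pos hz.periodic hql h, rfl⟩

theorem IsLyndonPower.eq_of_shift {α : Type*} [LinearOrder α] {x z : ℕ → α} {q p i : ℕ}
    (hx : IsLyndonPower x q) (hz : IsLyndonPower z p) (h : z = fun t => x (t + i)) : z = x := by
  have h1 : toLex x ≤ toLex z := h ▸ hx.least i
  refine toLex.injective (le_antisymm ?_ h1)
  have h2 : x = fun t => z (t + (i * q - i)) := by
    funext t
    have : i ≤ i * q := Nat.le_mul_of_pos_right i hx.pos
    rw [h]
    simp only
    rw [add_assoc, Nat.sub_add_cancel this]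
    exact (hx.periodic.nat_mul i t).symm
  rw [h2]
  exact hz.least _

theorem IsLyndonPower.fac_ne_prefix {α : Type*} [LinearOrder α] {x : ℕ → α} {q i l : ℕ}
    (hx : IsLyndonPower x q) (hql : q ≤ l) (hi : 0 < i) (hiq : i < q) :
    fac x 0 l ≠ fac x i l := by
  intro h
  have h1 := hx.periodic.eq_of_fac_eq hx.pos hx.periodic hql h
  obtain ⟨j, -, hj⟩ := hx.unbordered i hi hiq
  exact hj (congrFun h1 j).symm

/-! ### Connectedness and small circuits of Rauzy graphs -/

/-- Connectedness is expressed through functions constant along edges. Merging classes edge by edge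
loses at most one value per edge. -/
theorem Finset.card_le_card_add_one_of_connected {β γ : Type*} [DecidableEq β] [DecidableEq γ]
    (V : Finset β) (E : Finset γ) (s t : γ → β)
    (h : ∀ f : β → β, (∀ e ∈ E, f (s e) = f (t e)) → ∀ u ∈ V, ∀ v ∈ V, f u = f v) :
    V.card ≤ E.card + 1 := by
  have key : ∃ f : β → β, (∀ e ∈ E, f (s e) = f (t e)) ∧ V.card ≤ (V.image f).card + E.card := by
    clear h
    induction E using Finset.induction_on with
    | empty => exact ⟨id, by simp, by simp⟩
    | insert e E he ih =>
      obtain ⟨f, hf, hc⟩ := ih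
      rw [Finset.card_insert_of_notMem he]
      refine ⟨fun u => if f u = f (t e) then f (s e) else f u, ?_, ?_⟩
      · intro e' he'
        rcases Finset.mem_insert.1 he' with rfl | he'
        · by_cases h : f (s e') = f (t e') <;> simp [h]
        · simp [hf e' he']
      · have hsub : V.image f ⊆
            insert (f (t e)) (V.image fun u => if f u = f (t e) then f (s e) else f u) := by
          intro z hz
          obtain ⟨u, hu, rfl⟩ := Finset.mem_image.1 hz
          by_cases h : f u = f (t e)
          · simp [h]
          · exact Finset.mem_insert_of_mem (Finset.mem_image.2 ⟨u, hu, by simp [h]⟩)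
        have := (Finset.card_le_card hsub).trans (Finset.card_insert_le _ _)
        omega
  obtain ⟨f, hf, hc⟩ := key
  have : (V.image f).card ≤ 1 := by
    rw [Finset.card_le_one]
    intro a ha b hb
    obtain ⟨u, hu, rfl⟩ := Finset.mem_image.1 ha
    obtain ⟨v, hv, rfl⟩ := Finset.mem_image.1 hb
    exact h f hf u hu v hv
  omega

theorem eq_fac_of_walk {β : Type*} {y : ℕ → α} {l i j : ℕ} (f : List α → β) (hij : i ≤ j)
    (h : ∀ z, i ≤ z → z < j → f (fac y z l) = f (fac y (z + 1) l)) :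
    f (fac y i l) = f (fac y j l) := by
  induction j, hij using Nat.le_induction with
  | base => rfl
  | succ j hij ih =>
    exact (ih fun z hz hzj => h z hz (by omega)).trans (h j hij (by omega))

theorem dropLast_fac (x : ℕ → α) (i l : ℕ) : (fac x i (l + 1)).dropLast = fac x i l := by
  rw [fac_append]; simp [fac]

theorem tail_fac (x : ℕ → α) (i l : ℕ) : (fac x i (l + 1)).tail = fac x (i + 1) l := by
  rw [add_comm, fac_append]; simp [fac]

section

variable {α : Type*} [LinearOrder α]

/-- All blocks of length `l + 1` of the Lyndon power `x` of period `q ≤ l` occur in the prefix of length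
`n` of `y`: the blocks form a circuit of length `q` in the Rauzy graph of order `l`. -/
structure IsSmallCircuit (y : ℕ → α) (n l : ℕ) (x : ℕ → α) (q : ℕ) : Prop where
  isLyndonPower : IsLyndonPower x q
  le : q ≤ l
  mem : ∀ i, fac x i (l + 1) ∈ factors y n (l + 1)

open Classical in
/-- The edges of the Rauzy graph of order `l` that start with the Lyndon word of a small circuit. -/
noncomputable def circuitEdges (y : ℕ → α) (n l : ℕ) : Finset (List α) :=
  (factors y n (l + 1)).filter fun e => ∃ x q, IsSmallCircuit y n l x q ∧ e = fac x 0 (l + 1)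

theorem mem_circuitEdges {y : ℕ → α} {n l : ℕ} {e : List α} :
    e ∈ circuitEdges y n l ↔ ∃ x q, IsSmallCircuit y n l x q ∧ e = fac x 0 (l + 1) := by
  simp only [circuitEdges, Finset.mem_filter, and_iff_right_iff_imp]
  rintro ⟨x, q, h, rfl⟩
  exact h.mem 0

/-- The last letter reappears `q ≤ l` places earlier, inside the run of `a`. Hence the edge a^l b
lies on no small circuit. -/
theorem IsLyndonPower.replicate_concat_ne {x : ℕ → α} {q i l : ℕ} {a b : α}
    (hx : IsLyndonPower x q) (hq : q ≤ l) (hab : a ≠ b) :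
    fac x i (l + 1) ≠ List.replicate l a ++ [b] := by
  intro h
  rw [fac_append, List.append_eq_append_iff_of_size_eq_left (by simp), fac_eq_replicate] at h
  obtain ⟨h1, h2⟩ := h
  have h3 := h1 (l - q) (by have := hx.pos; omega)
  have h4 : x (i + l) = b := by simpa [fac] using h2
  rw [← hx.periodic, add_assoc, Nat.sub_add_cancel hq, h4] at h3
  exact hab h3.symm

/-- A function that is constant along all edges of the Rauzy graph outside the set of circuit edges and
one further edge `a⋯ab` is constant along all edges outside that one. -/
theorem eq_along_of_eq_along_sdiff {β : Type*} {y : ℕ → α} {n l : ℕ} {a b : α} (hab : a ≠ b)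
    (f : List α → β)
    (hf : ∀ e ∈ factors y n (l + 1), e ∉ circuitEdges y n l → e ≠ List.replicate l a ++ [b] →
      f e.dropLast = f e.tail) :
    ∀ e ∈ factors y n (l + 1), e ≠ List.replicate l a ++ [b] → f e.dropLast = f e.tail := by
  have key : ∀ q x, IsSmallCircuit y n l x q →
      f (fac x 0 (l + 1)).dropLast = f (fac x 0 (l + 1)).tail := by
    intro q
    induction q using Nat.strong_induction_on with
    | _ q ih =>
      intro x hx
      rw [dropLast_fac, tail_fac]
      have hpos := hx.isLyndonPower.pos
      have hwalk : f (fac x 1 l) = f (fac x q l) := by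
        refine eq_fac_of_walk f hpos fun z hz hzq => ?_
        rw [← dropLast_fac, ← tail_fac]
        -- Walking round the circuit the other way, any deleted circuit edge met belongs to a
        -- strictly shorter circuit: with equal length both would be the same Lyndon power,
        -- impossible at `0 < z < q`.
        by_cases hc : fac x z (l + 1) ∈ circuitEdges y n l
        · obtain ⟨x', q', hx', he⟩ := mem_circuitEdges.1 hc
          rw [he]
          refine ih q' (lt_of_le_of_ne ?_ ?_) x' hx'
          · exact hx'.isLyndonPower.le_of_periodic_prefix (hx'.le.trans l.le_succ) hpos
              hx.isLyndonPower.periodic he.symm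
          · rintro rfl
            have h1 := hx'.isLyndonPower.periodic.eq_of_fac_eq hpos hx.isLyndonPower.periodic
              (hx'.le.trans l.le_succ) he.symm
            have h2 := hx.isLyndonPower.eq_of_shift hx'.isLyndonPower h1
            rw [h2] at he
            exact hx.isLyndonPower.fac_ne_prefix (hx.le.trans l.le_succ) hz hzq he.symm
        · exact hf _ (hx.mem z) hc (hx.isLyndonPower.replicate_concat_ne hx.le hab)
      rw [zero_add, hwalk]
      have := fac_add_period hx.isLyndonPower.periodic 0 l
      rw [zero_add] at this
      rw [this]
  intro e he hne
  by_cases hc : e ∈ circuitEdges y n l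
  · obtain ⟨x, q, hx, rfl⟩ := mem_circuitEdges.1 hc
    exact key q x hx
  · exact hf e he hc hne

theorem card_circuitEdges_add_le {y : ℕ → α} {n l : ℕ} {a b : α} (hab : a ≠ b)
    (S : Finset (List α)) (hS : S ⊆ {List.replicate l a ++ [b]})
    (h : S.Nonempty → ∃ i j, i < j ∧ j + l ≤ n ∧ fac y i (l + 1) = List.replicate l a ++ [b] ∧
      fac y j l = List.replicate l a) :
    (factors y n l).card + (circuitEdges y n l).card + S.card ≤ (factors y n (l + 1)).card + 1 := by
  classical
  have hSE : S ⊆ factors y n (l + 1) := by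
    intro e he
    obtain ⟨i, j, hij, hj, hi, -⟩ := h ⟨e, he⟩
    rw [Finset.mem_singleton.1 (hS he)]
    exact mem_factors.2 ⟨i, by omega, hi⟩
  have hdisj : Disjoint (circuitEdges y n l) S := by
    rw [Finset.disjoint_left]
    intro e he heS
    obtain ⟨x, q, hx, rfl⟩ := mem_circuitEdges.1 he
    exact hx.isLyndonPower.replicate_concat_ne hx.le hab (Finset.mem_singleton.1 (hS heS))
  have hcard : (factors y n (l + 1) \ (circuitEdges y n l ∪ S)).card +
      ((circuitEdges y n l).card + S.card) = (factors y n (l + 1)).card := by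
    rw [← Finset.card_union_of_disjoint hdisj]
    exact Finset.card_sdiff_add_card_eq_card
      (Finset.union_subset (Finset.filter_subset _ _) hSE)
  have := Finset.card_le_card_add_one_of_connected (factors y n l)
    (factors y n (l + 1) \ (circuitEdges y n l ∪ S)) List.dropLast List.tail ?_
  · omega
  intro f hf
  have h1 := eq_along_of_eq_along_sdiff (y := y) (n := n) (l := l) hab f
    fun e he hc hne => hf e (by
      simp only [Finset.mem_sdiff, Finset.mem_union, he, hc, true_and, false_or]
      exact fun heS => hne (Finset.mem_singleton.1 (hS heS)))
  have h2 : ∀ e ∈ factors y n (l + 1), f e.dropLast = f e.tail := by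
    intro e he
    by_cases hne : e = List.replicate l a ++ [b]
    · by_cases hSn : S.Nonempty
      · obtain ⟨i, hex⟩ := h hSn
        -- At the first return `j` to a^l after `i`, the walk from `i + 1` to `j` has not used the
        -- deleted edge, which starts at a^l.
        obtain ⟨hij, hjn, hi, hj⟩ := Nat.find_spec hex
        have hmin := fun z (hz : z < Nat.find hex) => Nat.find_min hex hz
        generalize Nat.find hex = j at hij hjn hi hj hmin
        rw [hne, ← hi, tail_fac, dropLast_fac]
        have : fac y i l = fac y j l := by
          rw [hj, ← dropLast_fac, hi, List.dropLast_concat]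
        rw [this, eq_comm]
        refine eq_fac_of_walk f hij fun z hz hzj => ?_
        rw [← dropLast_fac, ← tail_fac]
        refine h1 _ (mem_factors.2 ⟨z, by omega, rfl⟩) fun hz' => ?_
        refine hmin z hzj ⟨by omega, by omega, hi, ?_⟩
        rw [← dropLast_fac, hz', List.dropLast_concat]
      · refine hf e ?_
        rw [Finset.not_nonempty_iff_eq_empty] at hSn
        simp only [hSn, Finset.union_empty, Finset.mem_sdiff, he, true_and]
        intro hc
        obtain ⟨x, q, hx, rfl⟩ := mem_circuitEdges.1 hc
        exact hx.isLyndonPower.replicate_concat_ne hx.le hab hne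
    · exact h1 e he hne
  have h3 : ∀ u ∈ factors y n l, f (fac y 0 l) = f u := by
    intro u hu
    obtain ⟨j, hj, rfl⟩ := mem_factors.1 hu
    refine eq_fac_of_walk f (Nat.zero_le j) fun z _ hz => ?_
    rw [← dropLast_fac, ← tail_fac]
    exact h2 _ (mem_factors.2 ⟨z, by omega, rfl⟩)
  intro u hu v hv
  rw [← h3 u hu, h3 v hv]

end

/-! ### Squares inject into circuits of odd type -/

theorem infix_fac_iff {α : Type*} [DecidableEq α] {y : ℕ → α} {n : ℕ} {v : List α} :
    v <:+: fac y 0 n ↔ v ∈ factors y n v.length := by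
  rw [mem_factors]
  constructor
  · rintro ⟨s, t, h⟩
    have hlen : s.length + v.length + t.length = n := by
      have := congrArg List.length h
      simpa [add_assoc] using this
    refine ⟨s.length, by omega, ?_⟩
    rw [← hlen, fac_append, fac_append, zero_add] at h
    exact ((List.append_inj (List.append_inj h (by simp)).1 (by simp)).2).symm
  · rintro ⟨i, hi, h⟩
    refine ⟨fac y 0 i, fac y (i + v.length) (n - (i + v.length)), ?_⟩
    rw [← h, length_fac]
    nth_rewrite 2 [← Nat.add_sub_cancel' hi]
    rw [fac_append, fac_append, zero_add, zero_add]

section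

variable {α : Type*} [LinearOrder α]

/-- The root is an `(m + 1)`-st power of a conjugate of a Lyndon word. Splitting one period off the
length leaves the odd multiple `2 * m + 1`, the later value of `l / q`. -/
theorem exists_lyndonPower_of_mem_squares {y : ℕ → α} {n : ℕ} {v : List α}
    (hv : v ∈ squares (fac y 0 n)) :
    ∃ x q m i, IsLyndonPower x q ∧ i < q ∧ v = fac x i ((2 * m + 1) * q + q) ∧
      v ∈ factors y n ((2 * m + 1) * q + q) := by
  obtain ⟨⟨u, hu, rfl⟩, hinf⟩ := hv
  have hpos : 0 < u.length := List.length_pos_iff.2 hu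
  obtain ⟨x, hper, hfac⟩ : ∃ x : ℕ → α, Function.Periodic x u.length ∧
      ∀ i, fac x (0 + i * u.length) u.length = u := by
    refine ⟨fun t => u[t % u.length]'(Nat.mod_lt _ hpos), fun t => by simp, fun i => ?_⟩
    refine List.ext_getElem (by simp) fun t ht ht' => ?_
    simp [fac, Nat.mod_eq_of_lt ht']
  obtain ⟨z, q, i, hz, ⟨c, hc⟩, hi, hzi⟩ := exists_isLyndonPower hpos hper
  have hcpos : c ≠ 0 := by rintro rfl; omega
  obtain ⟨m, rfl⟩ := Nat.exists_eq_succ_of_ne_zero hcpos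
  have hlen : (2 * m + 1) * q + q = u.length + u.length := by rw [hc, Nat.succ_eq_add_one]; ring
  rw [infix_fac_iff, List.length_append, ← hlen] at hinf
  refine ⟨z, q, m, i, hz, hi, ?_, hinf⟩
  have h0 := hfac 0
  have h1 := hfac 1
  rw [zero_mul, add_zero] at h0
  rw [one_mul] at h1
  have huu : u ++ u = fac x 0 (u.length + u.length) := by
    rw [fac_append, h0, h1]
  rw [hlen, huu, fac_eq_iff]
  intro t _
  rw [hzi, zero_add, add_comm]

/-- The edge `e` starts with the Lyndon word of a small circuit whose length goes into the order of the
graph an odd number of times. -/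
def IsOddEdge (y : ℕ → α) (n : ℕ) (e : List α) : Prop :=
  ∃ x q l, IsSmallCircuit y n l x q ∧ e = fac x 0 (l + 1) ∧ Odd (l / q)

theorem IsSmallCircuit.odd_of_isOddEdge {y : ℕ → α} {n l : ℕ} {x : ℕ → α} {q : ℕ}
    (h : IsSmallCircuit y n l x q) (ho : IsOddEdge y n (fac x 0 (l + 1))) : Odd (l / q) := by
  obtain ⟨x', q', l', h', he, hodd⟩ := ho
  have hl : l = l' := by simpa using congrArg List.length he
  subst hl
  obtain ⟨-, rfl⟩ := h.isLyndonPower.eq_of_prefix_eq h'.isLyndonPower (h.le.trans l.le_succ)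
    (h'.le.trans l.le_succ) he
  exact hodd

/-- If `r + 1` conjugates of a power of a Lyndon word occur, then the blocks that are shorter by
`q - r - 1` letters all occur. -/
theorem isSmallCircuit_of_count {y : ℕ → α} {n : ℕ} {x : ℕ → α} {q c i : ℕ} (hx : IsLyndonPower x q)
    (hc : 0 < c) (P : ℕ → Prop) [DecidablePred P]
    (hP : ∀ j, P j → fac x j (c * q + q) ∈ factors y n (c * q + q)) (hi : P i) (hiq : i < q) :
    IsSmallCircuit y n (c * q + Nat.count P i) x q := by
  have hcount : Nat.count P i ≤ i := Nat.count_le P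
  refine ⟨hx, by nlinarith, fun z => ?_⟩
  rw [← fac_mod_period hx.periodic]
  have hzq := Nat.mod_lt z hx.pos
  generalize z % q = z at hzq
  set r := Nat.count P i
  -- Pigeonhole: the `r + 1` starting points have distinct distances to `z` modulo `q`, so one is
  -- below `q - r`, and the block of length `c * q + r + 1` at `z` fits.
  obtain ⟨j, hj, hjq, hjr⟩ : ∃ j, P j ∧ j < q ∧ (z + q - j) % q + r < q := by
    by_contra! hcon
    have hcard : ((Finset.range (i + 1)).filter P).card = r + 1 := by
      rw [← Nat.count_eq_card_filter_range, Nat.count_succ, if_pos hi]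
    have hle := Finset.card_le_card_of_injOn (s := (Finset.range (i + 1)).filter P)
      (t := Finset.Ico (q - r) q) (fun j => (z + q - j) % q) ?_ ?_
    · rw [hcard, Nat.card_Ico] at hle
      omega
    · intro j hj
      simp only [Finset.coe_filter, Finset.mem_range, Set.mem_ofPred_eq] at hj
      have := hcon j hj.2 (by omega)
      have := Nat.mod_lt (z + q - j) hx.pos
      simp only [Finset.coe_Ico, Set.mem_Ico]
      omega
    · intro j hj j' hj' h
      simp only [Finset.coe_filter, Finset.mem_range, Set.mem_ofPred_eq] at hj hj'
      have e : ∀ j, j < q → (z + q - j) % q = if j ≤ z then z - j else z + q - j := by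
        intro j hj
        split_ifs with h
        · rw [Nat.sub_add_comm h, Nat.add_mod_right, Nat.mod_eq_of_lt (by omega)]
        · exact Nat.mod_eq_of_lt (by omega)
      simp only [e j (by omega), e j' (by omega)] at h
      split_ifs at h <;> omega
  have hmem := hP j hj
  rcases le_or_gt j z with hjz | hjz
  · rw [Nat.sub_add_comm hjz, Nat.add_mod_right, Nat.mod_eq_of_lt (by omega)] at hjr
    exact fac_mem_factors_of_le hmem hjz (by omega)
  · rw [Nat.mod_eq_of_lt (by omega)] at hjr
    rw [← fac_add_period hx.periodic]
    exact fac_mem_factors_of_le hmem (by omega) (by omega)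

theorem IsSmallCircuit.mem_biUnion {y : ℕ → α} {n l : ℕ} {x : ℕ → α} {q : ℕ}
    (h : IsSmallCircuit y n l x q) :
    fac x 0 (l + 1) ∈ (Finset.Icc 1 (n - 1)).biUnion (circuitEdges y n) := by
  have := h.isLyndonPower.pos
  have := h.le
  obtain ⟨i, hi, -⟩ := mem_factors.1 (h.mem 0)
  exact Finset.mem_biUnion.2 ⟨l, Finset.mem_Icc.2 ⟨by omega, by omega⟩,
    mem_circuitEdges.2 ⟨x, q, h, rfl⟩⟩

-- A square preceded by `r` occurring conjugates goes to the circuit of order `(2 * m + 1) * q + r`.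
-- The edge determines the Lyndon power and `q`, then `m` by division, then `r` and so the
-- conjugate.
open Classical in
theorem numSquares_le_card_oddEdges (y : ℕ → α) (n : ℕ) :
    numSquares (fac y 0 n) ≤
      (((Finset.Icc 1 (n - 1)).biUnion (circuitEdges y n)).filter (IsOddEdge y n)).card := by
  have hex : ∀ v : List α, ∃ (x : ℕ → α) (q m i : ℕ), v ∈ squares (fac y 0 n) →
      IsLyndonPower x q ∧ i < q ∧ v = fac x i ((2 * m + 1) * q + q) ∧
      v ∈ factors y n ((2 * m + 1) * q + q) := by
    intro v
    by_cases hv : v ∈ squares (fac y 0 n)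
    · obtain ⟨x, q, m, i, h⟩ := exists_lyndonPower_of_mem_squares hv
      exact ⟨x, q, m, i, fun _ => h⟩
    · exact ⟨fun _ => y 0, 0, 0, 0, fun h => absurd h hv⟩
  choose X Q M I hspec using hex
  let P : List α → ℕ → Prop := fun v j =>
    fac (X v) j ((2 * M v + 1) * Q v + Q v) ∈ factors y n ((2 * M v + 1) * Q v + Q v)
  have hP : ∀ v ∈ squares (fac y 0 n), P v (I v) := by
    intro v hv
    obtain ⟨-, -, h1, h2⟩ := hspec v hv
    change fac (X v) (I v) _ ∈ _
    rw [← h1]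
    exact h2
  have hcirc : ∀ v ∈ squares (fac y 0 n),
      IsSmallCircuit y n ((2 * M v + 1) * Q v + Nat.count (P v) (I v)) (X v) (Q v) :=
    fun v hv => isSmallCircuit_of_count (hspec v hv).1 (Nat.succ_pos _) (P v) (fun j hj => hj)
      (hP v hv) (hspec v hv).2.1
  have hlt : ∀ v ∈ squares (fac y 0 n), Nat.count (P v) (I v) < Q v :=
    fun v hv => (Nat.count_le _).trans_lt (hspec v hv).2.1
  have hdiv : ∀ v ∈ squares (fac y 0 n),
      ((2 * M v + 1) * Q v + Nat.count (P v) (I v)) / Q v = 2 * M v + 1 := by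
    intro v hv
    rw [add_comm, Nat.add_mul_div_right _ _ (hspec v hv).1.pos, Nat.div_eq_of_lt (hlt v hv), zero_add]
  rw [numSquares, ← Set.ncard_coe_finset]
  refine Set.ncard_le_ncard_of_injOn
    (fun v => fac (X v) 0 ((2 * M v + 1) * Q v + Nat.count (P v) (I v) + 1)) ?_ ?_
    (Finset.finite_toSet _)
  · intro v hv
    simp only [Finset.coe_filter, Set.mem_ofPred_eq]
    refine ⟨(hcirc v hv).mem_biUnion, _, _, _, hcirc v hv, rfl, ?_⟩
    rw [hdiv v hv]
    exact odd_two_mul_add_one _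
  · intro v hv v' hv' he
    have hl : (2 * M v + 1) * Q v + Nat.count (P v) (I v) =
        (2 * M v' + 1) * Q v' + Nat.count (P v') (I v') := by
      simpa using congrArg List.length he
    simp only at he
    rw [← hl] at he
    have hle' := (hcirc v' hv').le
    rw [← hl] at hle'
    obtain ⟨hX, hQ⟩ := (hspec v hv).1.eq_of_prefix_eq (hspec v' hv').1
      ((hcirc v hv).le.trans (Nat.le_succ _)) (hle'.trans (Nat.le_succ _)) he
    have hM : M v = M v' := by
      have h1 := hdiv v hv
      rw [hl, hQ, hdiv v' hv'] at h1
      omega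
    have hPP : P v = P v' := by
      funext j
      simp only [P, hX, hQ, hM]
    have hPv := hP v hv
    have hIv : I v = I v' := by
      refine Nat.count_injective (p := P v) hPv (hPP ▸ hP v' hv') ?_
      have hmul : (2 * M v + 1) * Q v = (2 * M v' + 1) * Q v' := by rw [hQ, hM]
      refine (Nat.add_left_cancel (hl.trans (congrArg (· + _) hmul.symm))).trans ?_
      congr! 1
      exact hPP.symm
    rw [(hspec v hv).2.2.1, (hspec v' hv').2.2.1, hX, hQ, hM, hIv]

/-! ### Summation over the orders -/

theorem card_factors_self (y : ℕ → α) (n : ℕ) : (factors y n n).card = 1 := by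
  simp [factors]

theorem card_biUnion_circuitEdges_add_le {y : ℕ → α} {n B : ℕ} {a b : α} (hab : a ≠ b)
    (hn : 1 ≤ n)
    (h : ∀ l, 1 ≤ l → l ≤ B → ∃ i j, i < j ∧ j + l ≤ n ∧
      fac y i (l + 1) = List.replicate l a ++ [b] ∧ fac y j l = List.replicate l a) :
    ((Finset.Icc 1 (n - 1)).biUnion (circuitEdges y n)).card + B + (factors y n 1).card ≤ n := by
  have key : ∀ N, N + 1 ≤ n → ∑ l ∈ Finset.Icc 1 N, (circuitEdges y n l).card + min B N +
      (factors y n 1).card ≤ (factors y n (N + 1)).card + N := by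
    intro N
    induction N with
    | zero => simp
    | succ N ih =>
      intro hN
      have ih := ih (by omega)
      rw [Finset.sum_Icc_succ_top (by omega)]
      have := card_circuitEdges_add_le (y := y) (n := n) (l := N + 1) hab
        (if N + 1 ≤ B then {List.replicate (N + 1) a ++ [b]} else ∅) (by split_ifs <;> simp)
        (by
          split_ifs with hNB
          · exact fun _ => h _ (by omega) hNB
          · simp)
      split_ifs at this with hNB
      · rw [Finset.card_singleton] at this
        omega
      · rw [Finset.card_empty] at this
        omega
  have hB : B ≤ n - 1 := by
    rcases Nat.eq_zero_or_pos B with rfl | hB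
    · exact Nat.zero_le _
    · obtain ⟨i, j, hij, hj, -⟩ := h B hB le_rfl
      omega
  have hkey := key (n - 1) (by omega)
  rw [Nat.sub_add_cancel hn, card_factors_self, min_eq_left hB] at hkey
  have := Finset.card_biUnion_le (s := Finset.Icc 1 (n - 1)) (t := circuitEdges y n)
  omega

theorem isLyndonPower_const (a : α) : IsLyndonPower (fun _ => a) 1 :=
  ⟨Nat.one_pos, fun _ => rfl, fun _ h h' => absurd h' (by omega), fun _ => le_rfl⟩

/-- The number of squares falls short of the length of the word by what the small circuits of even
type, the returns to `a⋯a`, and the letters contribute. -/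
theorem numSquares_add_le {y : ℕ → α} {n A B δ : ℕ} {a b : α} (hab : a ≠ b) (hn : 1 ≤ n)
    (hA : List.replicate A a ∈ factors y n A)
    (h : ∀ l, 1 ≤ l → l ≤ B → ∃ i j, i < j ∧ j + l ≤ n ∧
      fac y i (l + 1) = List.replicate l a ++ [b] ∧ fac y j l = List.replicate l a)
    (hδ : δ = 0 ∨ δ = 1 ∧ ∃ x q, x ≠ (fun _ => a) ∧ IsSmallCircuit y n (2 * q) x q) :
    numSquares (fac y 0 n) + (A - 1) / 2 + δ + B + (factors y n 1).card ≤ n := by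
  classical
  have hU := card_biUnion_circuitEdges_add_le hab hn h
  have hodd := numSquares_le_card_oddEdges y n
  set U := (Finset.Icc 1 (n - 1)).biUnion (circuitEdges y n)
  have hsplit := Finset.card_filter_add_card_filter_not (s := U) (IsOddEdge y n)
  have hcirc : ∀ t < (A - 1) / 2, IsSmallCircuit y n (2 * t + 2) (fun _ => a) 1 := by
    intro t ht
    refine ⟨isLyndonPower_const a, by omega, fun i => ?_⟩
    obtain ⟨j, hj, hja⟩ := mem_factors.1 hA
    refine mem_factors.2 ⟨j, by omega, fac_eq_iff.2 fun s hs => ?_⟩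
    exact fac_eq_replicate.1 hja s (by omega)
  have hWa : (Finset.range ((A - 1) / 2)).image (fun t => fac (fun _ => a) 0 (2 * t + 2 + 1)) ⊆
      U.filter fun e => ¬ IsOddEdge y n e := by
    intro e he
    obtain ⟨t, ht, rfl⟩ := Finset.mem_image.1 he
    have hc := hcirc t (Finset.mem_range.1 ht)
    refine Finset.mem_filter.2 ⟨hc.mem_biUnion, fun ho => ?_⟩
    have := hc.odd_of_isOddEdge ho
    rw [Nat.div_one, Nat.odd_iff] at this
    omega
  have hcard : ((Finset.range ((A - 1) / 2)).image
      (fun t => fac (fun _ => a) 0 (2 * t + 2 + 1))).card = (A - 1) / 2 := by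
    rw [Finset.card_image_of_injective, Finset.card_range]
    intro t t' htt
    have := congrArg List.length htt
    simpa using this
  have hmain : (A - 1) / 2 + δ ≤ (U.filter fun e => ¬ IsOddEdge y n e).card := by
    rcases hδ with rfl | ⟨rfl, x, q, hxa, hx⟩
    · rw [← hcard]
      exact Finset.card_le_card hWa
    · have hnot : fac x 0 (2 * q + 1) ∉ (Finset.range ((A - 1) / 2)).image
          (fun t => fac (fun _ => a) 0 (2 * t + 2 + 1)) := by
        intro hmem
        obtain ⟨t, -, he⟩ := Finset.mem_image.1 hmem
        have hl : 2 * t + 2 = 2 * q := by simpa using congrArg List.length he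
        rw [hl] at he
        have := hx.isLyndonPower.pos
        exact hxa ((isLyndonPower_const a).eq_of_prefix_eq hx.isLyndonPower
          (by omega) (by omega) he).1.symm
      rw [← hcard, ← Finset.card_insert_of_notMem hnot]
      refine Finset.card_le_card (Finset.insert_subset (Finset.mem_filter.2 ⟨hx.mem_biUnion, ?_⟩) hWa)
      intro ho
      have := hx.odd_of_isOddEdge ho
      rw [Nat.mul_div_cancel _ hx.isLyndonPower.pos] at this
      exact absurd this (by decide)
  omega

end

/-! ### Run lengths -/

theorem fac_eq_of_append {α : Type*} {y : ℕ → α} {n : ℕ} {s v t : List α}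
    (h : fac y 0 n = s ++ (v ++ t)) :
    fac y s.length v.length = v ∧ s.length + v.length + t.length = n := by
  have hlen : s.length + v.length + t.length = n := by
    have := congrArg List.length h
    simpa [add_assoc] using this.symm
  rw [← hlen, fac_append, fac_append, zero_add, List.append_assoc] at h
  exact ⟨(List.append_inj (List.append_inj h (by simp)).2 (by simp)).1, hlen⟩

/-- The word made of the blocks `a⋯ab` with the given numbers of letters `a`. -/
def encodeRuns {α : Type*} (a b : α) (rs : List ℕ) : List α :=
  rs.flatMap fun r => List.replicate r a ++ [b]

section

variable {α : Type*} (a b : α)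

@[simp] theorem encodeRuns_nil : encodeRuns a b [] = [] := rfl

@[simp] theorem encodeRuns_cons (r : ℕ) (rs : List ℕ) :
    encodeRuns a b (r :: rs) = List.replicate r a ++ (b :: encodeRuns a b rs) := by
  simp [encodeRuns]

@[simp] theorem encodeRuns_append (rs rs' : List ℕ) :
    encodeRuns a b (rs ++ rs') = encodeRuns a b rs ++ encodeRuns a b rs' := by
  simp [encodeRuns]

theorem length_encodeRuns (rs : List ℕ) : (encodeRuns a b rs).length = rs.sum + rs.length := by
  induction rs with
  | nil => rfl
  | cons r rs ih => simp [ih]; omega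

theorem exists_encodeRuns [DecidableEq α] {a b : α} (hab : a ≠ b) (w : List α)
    (hw : ∀ c ∈ w, c = a ∨ c = b) :
    ∃ rs : List ℕ, w ++ [b] = encodeRuns a b rs ∧ rs.length = w.count b + 1 := by
  induction w with
  | nil => exact ⟨[0], by simp⟩
  | cons c w ih =>
    obtain ⟨rs, h, hl⟩ := ih fun c hc => hw c (List.mem_cons_of_mem _ hc)
    rcases hw c List.mem_cons_self with rfl | rfl
    · cases rs with
      | nil => simp at hl
      | cons r rs =>
        refine ⟨(r + 1) :: rs, ?_, ?_⟩
        · rw [List.cons_append, h]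
          simp [List.replicate_succ]
        · rw [List.count_cons_of_ne hab]
          exact hl
    · exact ⟨0 :: rs, by simp [h], by simp [hl]⟩

end

/-- A run shorter than `A` saves at least 3, paying for itself and up to two maximal runs before it;
the `+ 2` covers maximal runs at the end. -/
theorem List.length_add_three_mul_sum_le {A : ℕ} : ∀ rs : List ℕ, (∀ r ∈ rs, r ≤ A) →
    ¬ [A, A, A] <:+: rs → rs.length + 3 * rs.sum ≤ 3 * (A * rs.length) + 2
  | [], _, _ => by simp
  | r :: rs, hle, hinf => by
    have hr := hle r (by simp)
    have ih := List.length_add_three_mul_sum_le rs (fun r' h => hle r' (by simp [h]))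
      fun h => hinf (List.infix_cons h)
    by_cases hrA : r = A
    · subst hrA
      match rs, hle, hinf, ih with
      | [], _, _, _ => simp; omega
      | r' :: rs, hle, hinf, _ =>
        have hr' := hle r' (by simp)
        have ih' := List.length_add_three_mul_sum_le rs (fun r h => hle r (by simp [h]))
          fun h => hinf (List.infix_cons (List.infix_cons h))
        by_cases hrA' : r' = r
        · subst hrA'
          match rs, hle, hinf, ih' with
          | [], _, _, _ => simp; omega
          | r'' :: rs, hle, hinf, _ =>
            have hr'' := hle r'' (by simp)
            have ih'' := List.length_add_three_mul_sum_le rs (fun r h => hle r (by simp [h]))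
              fun h => hinf (List.infix_cons (List.infix_cons (List.infix_cons h)))
            have hne : r'' ≠ r' := by
              rintro rfl
              exact hinf ⟨[], rs, rfl⟩
            simp only [List.length_cons, List.sum_cons, Nat.mul_add, mul_one] at ih'' ⊢
            omega
        · simp only [List.length_cons, List.sum_cons, Nat.mul_add, mul_one] at ih' ⊢
          omega
    · simp only [List.length_cons, List.sum_cons, Nat.mul_add, mul_one] at ih ⊢
      omega

theorem List.exists_max_append {l : List ℕ} (hl : l ≠ []) :
    ∃ m l₁ l₂, l = l₁ ++ m :: l₂ ∧ ∀ r ∈ l, r ≤ m := by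
  obtain ⟨m, hm, hmax⟩ := Finset.exists_max_image l.toFinset id
    ((List.toFinset_nonempty_iff l).2 hl)
  obtain ⟨l₁, l₂, h⟩ := List.append_of_mem (List.mem_toFinset.1 hm)
  exact ⟨m, l₁, l₂, h, fun r hr => hmax r (List.mem_toFinset.2 hr)⟩

/-- `r` and `r'` only mark two places, in order, with at least `B` letters each; which of them is
the longest is immaterial. -/
theorem List.exists_two_max {rs : List ℕ} {k : ℕ} (hk : 0 < k) (hrs : rs.length = k + 1) :
    ∃ A B r r' l₁ l₂ l₃, rs = l₁ ++ r :: (l₂ ++ r' :: l₃) ∧ B ≤ r ∧ B ≤ r' ∧ B ≤ A ∧ A ∈ rs ∧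
      (∀ r ∈ rs, r ≤ A) ∧ rs.sum ≤ A + k * B := by
  obtain ⟨A, l₁, l₂, h, hA⟩ := List.exists_max_append (l := rs) (by rintro rfl; simp at hrs)
  have hlen : (l₁ ++ l₂).length = k := by
    rw [h] at hrs
    simp at hrs ⊢
    omega
  obtain ⟨B, m₁, m₂, h', hB⟩ := List.exists_max_append (l := l₁ ++ l₂)
    (by intro h0; rw [h0] at hlen; simp at hlen; omega)
  have hsum : rs.sum ≤ A + k * B := by
    have := List.sum_le_card_nsmul _ B hB
    rw [hlen, smul_eq_mul] at this
    rw [h]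
    simp at this ⊢
    omega
  have hBmem : B ∈ l₁ ++ l₂ := by rw [h']; simp
  have hBA : B ≤ A := by
    refine hA B ?_
    rw [h]
    simp at hBmem ⊢
    tauto
  have hAmem : A ∈ rs := by rw [h]; simp
  rcases List.mem_append.1 hBmem with hm | hm
  · obtain ⟨n₁, n₂, rfl⟩ := List.append_of_mem hm
    exact ⟨A, B, B, A, n₁, n₂, l₂, by rw [h]; simp, le_rfl, hBA, hBA, hAmem, hA, hsum⟩
  · obtain ⟨n₁, n₂, rfl⟩ := List.append_of_mem hm
    exact ⟨A, B, A, B, l₁, n₁, n₂, h, hBA, le_rfl, hBA, hAmem, hA, hsum⟩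

/-! ### Cubes of a^A b and the final estimate -/

section

variable {α : Type*}

theorem fac_mem_factors_of_cube [DecidableEq α] {y z : ℕ → α} {n q i : ℕ} (hq : 0 < q)
    (hz : Function.Periodic z q) (h : fac z i (3 * q) ∈ factors y n (3 * q)) (j : ℕ) :
    fac z j (2 * q + 1) ∈ factors y n (2 * q + 1) := by
  -- `i * q - i` stands for `-i` modulo `q`. A cube has exactly `q` starting positions for blocks of
  -- length `2 * q + 1`.
  have hi : i ≤ i * q := Nat.le_mul_of_pos_right i hq
  have hmod := Nat.mod_lt (j + (i * q - i)) hq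
  have heq : fac z j (2 * q + 1) = fac z (i + (j + (i * q - i)) % q) (2 * q + 1) := by
    rw [← fac_mod_period hz (i + _), Nat.add_mod_mod, ← fac_mod_period hz j]
    congr 1
    rw [show i + (j + (i * q - i)) = j + i * q by omega, Nat.add_mul_mod_self_right]
  rw [heq]
  exact fac_mem_factors_of_le h (by omega) (by omega)

/-- The infinite power of `a⋯ab`, with `A` letters `a`. -/
def runStream (a b : α) (A t : ℕ) : α := if t % (A + 1) = A then b else a

theorem periodic_runStream (a b : α) (A : ℕ) : Function.Periodic (runStream a b A) (A + 1) :=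
  fun t => by simp [runStream]

theorem fac_runStream (a b : α) (A : ℕ) :
    fac (runStream a b A) 0 (A + 1) = List.replicate A a ++ [b] := by
  rw [fac_append]
  congr 1
  · rw [fac_eq_replicate]
    intro t ht
    have : t % (A + 1) ≠ A := by rw [Nat.mod_eq_of_lt (by omega)]; omega
    rw [zero_add]
    simp [runStream, this]
  · simp [fac, runStream]

theorem fac_runStream_three (a b : α) (A : ℕ) :
    fac (runStream a b A) 0 (3 * (A + 1)) = encodeRuns a b [A, A, A] := by
  have h : ∀ i, fac (runStream a b A) (0 + i * (A + 1)) (A + 1) = List.replicate A a ++ [b] := by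
    intro i
    rw [← fac_runStream, ← fac_mod_period (periodic_runStream a b A), Nat.add_mul_mod_self_right,
      Nat.zero_mod]
  have h1 := h 1
  have h2 := h 2
  rw [show 3 * (A + 1) = (A + 1) + ((A + 1) + (A + 1)) by ring, fac_append _ 0 (A + 1),
    fac_append _ _ (A + 1) (A + 1), fac_runStream]
  rw [show 0 + (A + 1) + (A + 1) = 0 + 2 * (A + 1) by ring, h2,
    show 0 + (A + 1) = 0 + 1 * (A + 1) by ring, h1]
  simp [encodeRuns]

/-- The final b of the encoding is outside the prefix of length `n`. A cube ending there is shifted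
back by one letter, onto the b of a preceding run, which exists as there are more than three runs.
-/
theorem exists_cube_mem_factors [DecidableEq α] {y : ℕ → α} {n A : ℕ} {a b : α} {rs : List ℕ}
    (hy : fac y 0 (n + 1) = encodeRuns a b rs) (hinf : [A, A, A] <:+: rs) (hlen : 3 < rs.length) :
    ∃ i, fac (runStream a b A) i (3 * (A + 1)) ∈ factors y n (3 * (A + 1)) := by
  obtain ⟨m₁, m₂, rfl⟩ := hinf
  rw [List.append_assoc, encodeRuns_append, encodeRuns_append, ← fac_runStream_three] at hy
  by_cases hm₂ : m₂ = []
  · subst hm₂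
    have hm₁ : m₁ ≠ [] := by rintro rfl; simp at hlen
    obtain ⟨m, r, rfl⟩ : ∃ m r, m₁ = m ++ [r] := ⟨_, _, (List.dropLast_append_getLast hm₁).symm⟩
    have hb : fac (runStream a b A) A (1 + 3 * (A + 1)) =
        [b] ++ fac (runStream a b A) 0 (3 * (A + 1)) := by
      rw [fac_append]
      congr 1
      · simp [fac, runStream]
      · rw [← fac_mod_period (periodic_runStream a b A), Nat.mod_self]
    have hy' : fac y 0 (n + 1) = (encodeRuns a b m ++ List.replicate r a) ++
        (fac (runStream a b A) A (1 + 3 * (A + 1)) ++ []) := by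
      rw [hy, hb]
      simp
    obtain ⟨h1, h2⟩ := fac_eq_of_append hy'
    rw [length_fac] at h1 h2
    rw [fac_eq_iff] at h1
    exact ⟨A, mem_factors.2 ⟨_, by simp at h2 ⊢; omega, fac_eq_iff.2 fun t ht => h1 t (by omega)⟩⟩
  · obtain ⟨h1, h2⟩ := fac_eq_of_append hy
    have := length_encodeRuns a b m₂
    have := List.length_pos_iff.2 hm₂
    rw [length_fac] at h1 h2
    exact ⟨0, mem_factors.2 ⟨_, by omega, h1⟩⟩

theorem exists_isSmallCircuit_of_cube [LinearOrder α] {y : ℕ → α} {n A i : ℕ} {a b : α} (hab : a ≠ b)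
    (h : fac (runStream a b A) i (3 * (A + 1)) ∈ factors y n (3 * (A + 1))) :
    ∃ x q, x ≠ (fun _ => a) ∧ IsSmallCircuit y n (2 * q) x q := by
  have hper := periodic_runStream a b A
  obtain ⟨x, q, j, hx, hdvd, hj, hz⟩ := exists_isLyndonPower A.succ_pos hper
  have hzA : runStream a b A A = b := by simp [runStream]
  have hq : q = A + 1 := by
    -- A shorter period would force a `b` at residue `q - 1 ≠ A`.
    refine (Nat.le_of_dvd A.succ_pos hdvd).eq_of_not_lt fun hlt => ?_
    have h1 : runStream a b A (A + q) = b := by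
      rw [hz, add_right_comm, hx.periodic, ← hz, hzA]
    have hpos := hx.pos
    have h2 : (A + q) % (A + 1) ≠ A := by
      rw [show A + q = q - 1 + (A + 1) by omega, Nat.add_mod_right, Nat.mod_eq_of_lt (by omega)]
      omega
    simp only [runStream, if_neg h2] at h1
    exact hab h1
  subst hq
  refine ⟨x, A + 1, ?_, hx, by omega, fun c => ?_⟩
  · rintro rfl
    rw [hz] at hzA
    exact hab hzA
  · have : fac x c (2 * (A + 1) + 1) = fac (runStream a b A) (c + (A + 1 - j)) (2 * (A + 1) + 1) := by
      rw [fac_eq_iff]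
      intro t _
      rw [hz, ← hx.periodic]
      congr 1
      omega
    rw [this]
    exact fac_mem_factors_of_cube A.succ_pos hper h _

theorem numSquares_mul_le [LinearOrder α] {w : List α} {a b : α} {k : ℕ} {rs : List ℕ} (hab : a ≠ b)
    (ha : a ∈ w) (hb : b ∈ w) (hk : 2 ≤ k) (hw : w ++ [b] = encodeRuns a b rs)
    (hrs : rs.length = k + 1) :
    (2 * k + 2) * numSquares w + w.length ≤ 2 * k * w.length := by
  obtain ⟨y, hy⟩ : ∃ y : ℕ → α, fac y 0 (w.length + 1) = w ++ [b] := by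
    refine ⟨fun i => (w ++ [b]).getD i b, List.ext_getElem (by simp) fun t ht ht' => ?_⟩
    simp only [fac, zero_add, List.getElem_map, List.getElem_range]
    exact List.getD_eq_getElem _ _ ht'
  have hlen : w.length + 1 = rs.sum + (k + 1) := by
    rw [← hrs, ← length_encodeRuns a b, ← hw]
    simp
  generalize hn : w.length = n at hy hlen ⊢
  have hyw : fac y 0 n = w := by
    rw [fac_append] at hy
    exact (List.append_inj hy (by simp [hn])).1
  have hc : 2 ≤ (factors y n 1).card := by
    have hsub : ({[a], [b]} : Finset (List α)) ⊆ factors y n 1 := by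
      intro v hv
      have hmem : ∀ c ∈ w, [c] ∈ factors y n 1 := by
        intro c hc
        obtain ⟨s, t, hst⟩ := List.append_of_mem hc
        exact infix_fac_iff.1 (hyw ▸ ⟨s, t, by simp [hst]⟩)
      rcases Finset.mem_insert.1 hv with rfl | hv
      · exact hmem a ha
      · rw [Finset.mem_singleton.1 hv]
        exact hmem b hb
    have := Finset.card_le_card hsub
    rwa [Finset.card_pair (by simpa using hab)] at this
  rw [hw] at hy
  obtain ⟨A, B, r, r', l₁, l₂, l₃, hsplit, hBr, hBr', hBA, hA, hmax, hsum⟩ :=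
    List.exists_two_max (k := k) (by omega) hrs
  have hrunA : List.replicate A a ∈ factors y n A := by
    obtain ⟨m₁, m₂, hm⟩ := List.append_of_mem hA
    have hy' := hy
    rw [hm, encodeRuns_append, encodeRuns_cons] at hy'
    obtain ⟨h1, h2⟩ := fac_eq_of_append hy'
    rw [List.length_replicate] at h1 h2
    exact mem_factors.2 ⟨_, by simp at h2; omega, h1⟩
  have hret : ∀ l, 1 ≤ l → l ≤ B → ∃ i j, i < j ∧ j + l ≤ n ∧
      fac y i (l + 1) = List.replicate l a ++ [b] ∧ fac y j l = List.replicate l a := by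
    intro l _ hlB
    have hr : List.replicate r a = List.replicate (r - l) a ++ List.replicate l a := by
      rw [List.replicate_append_replicate, Nat.sub_add_cancel (by omega)]
    have hr' : List.replicate r' a = List.replicate l a ++ List.replicate (r' - l) a := by
      rw [List.replicate_append_replicate, Nat.add_sub_cancel' (by omega)]
    have h1 : fac y 0 (n + 1) = (encodeRuns a b l₁ ++ List.replicate (r - l) a) ++
        ((List.replicate l a ++ [b]) ++ encodeRuns a b (l₂ ++ r' :: l₃)) := by
      rw [hy, hsplit, encodeRuns_append, encodeRuns_cons, hr]
      simp only [List.append_assoc, List.singleton_append]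
    have h2 : fac y 0 (n + 1) = (encodeRuns a b l₁ ++ List.replicate r a ++ [b] ++ encodeRuns a b l₂) ++
        (List.replicate l a ++ (List.replicate (r' - l) a ++ b :: encodeRuns a b l₃)) := by
      rw [hy, hsplit, encodeRuns_append, encodeRuns_cons, encodeRuns_append, encodeRuns_cons, hr']
      simp only [List.append_assoc, List.cons_append, List.nil_append]
    obtain ⟨h1, -⟩ := fac_eq_of_append h1
    obtain ⟨h2, h3⟩ := fac_eq_of_append h2
    refine ⟨_, _, ?_, ?_, by simpa using h1, by simpa using h2⟩
    · simp
      omega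
    · simp at h3 ⊢
      omega
  have hn1 : 1 ≤ n := by omega
  rcases hBA.eq_or_lt with rfl | hlt
  -- The goal is that `k + 1` times twice the deficit is at least `3 * n`. With the cube, twice the
  -- deficit is at least `3 * B + 4`, which suffices; otherwise `3 * B + 2` is enough for `k = 2`,
  -- or by the bound on the sum of runs.
  · by_cases hδ : [B, B, B] <:+: rs ∧ 3 ≤ k
    · obtain ⟨i, hi⟩ := exists_cube_mem_factors hy hδ.1 (by omega)
      have := numSquares_add_le (δ := 1) hab hn1 hrunA hret
        (Or.inr ⟨rfl, exists_isSmallCircuit_of_cube hab hi⟩)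
      rw [hyw] at this
      have h2 : 2 * numSquares w + (3 * B + 4) ≤ 2 * n := by omega
      nlinarith
    · have := numSquares_add_le (δ := 0) hab hn1 hrunA hret (Or.inl rfl)
      rw [hyw] at this
      have h2 : 2 * numSquares w + (3 * B + 2) ≤ 2 * n := by omega
      have h3 : k + 3 * rs.sum ≤ 3 * (B * (k + 1)) + 2 := by
        by_cases hk3 : 3 ≤ k
        · have := List.length_add_three_mul_sum_le rs hmax fun h => hδ ⟨h, hk3⟩
          rw [hrs] at this
          omega
        · obtain rfl : k = 2 := by omega
          omega
      nlinarith
  · have := numSquares_add_le (δ := 0) hab hn1 hrunA hret (Or.inl rfl)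
    rw [hyw] at this
    obtain ⟨e, rfl⟩ := Nat.exists_eq_add_of_lt hlt
    obtain ⟨c, rfl⟩ := Nat.exists_eq_add_of_le hk
    have h2 : 2 * numSquares w + (3 * B + 3 + e) ≤ 2 * n := by omega
    have h4 := Nat.mul_le_mul_left (2 + c + 1) h2
    -- With `A = B + e + 1` and `k = 2 + c`, the surplus is at least `(k + 1) * e - 3 * e = c * e`.
    nlinarith [Nat.zero_le (c * e)]

end

/-- Lyndon words need some linear order on the letters; it plays no part in which letter is rarer.
-/
instance : LinearOrder Letter :=
  LinearOrder.lift' (fun c => if c = Letter.a then 0 else 1 : Letter → ℕ) fun c d h => by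
    cases c <;> cases d <;> simp_all

theorem numSquares_mul_le_of_count {w : List Letter} {c d : Letter} {k : ℕ} (hcd : c ≠ d)
    (hk2 : 2 ≤ k) (hc : k ≤ w.count c) (hd : w.count d = k) :
    (2 * k + 2) * numSquares w + w.length ≤ 2 * k * w.length := by
  obtain ⟨rs, hw, hrs⟩ := exists_encodeRuns hcd w fun e _ => by
    cases c <;> cases d <;> cases e <;> simp_all
  exact numSquares_mul_le hcd (List.count_pos_iff.1 (by omega)) (List.count_pos_iff.1 (by omega)) hk2
    hw (by omega)

theorem theorem2 (w : List Letter) (k : ℕ)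
    (hk : k = min (w.count Letter.a) (w.count Letter.b)) (hk2 : 2 ≤ k) :
    (numSquares w : ℝ) ≤ (2 * (k : ℝ) - 1) / (2 * (k : ℝ) + 2) * (w.length : ℝ) := by
  have key : (2 * k + 2) * numSquares w + w.length ≤ 2 * k * w.length := by
    rcases le_total (w.count Letter.a) (w.count Letter.b) with h | h
    · exact numSquares_mul_le_of_count (c := Letter.b) (d := Letter.a) (by simp) hk2 (by omega)
        (by omega)
    · exact numSquares_mul_le_of_count (c := Letter.a) (d := Letter.b) (by simp) hk2 (by omega)
        (by omega)
  have hpos : (0 : ℝ) < 2 * k + 2 := by positivity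
  rw [div_mul_eq_mul_div, le_div_iff₀ hpos]
  have : ((2 * k + 2) * numSquares w + w.length : ℝ) ≤ 2 * k * w.length := by exact_mod_cast key
  linarith
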